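/- A positively ordered monoid is a commutative monoid with a translation invariant partial order whose least element is $0$; together with the maps preserving addition, order and zero these form the category $\mathrm{PoM}$. In a partially ordered set write $x\ll y$ if for every increasing sequence $(y_n)_n$ whose supremum exists and satisfies $y\le\sup_n y_n$ there is $k$ with $x\le y_k$. A $\mathrm{Cu}$-semigroup is a positively ordered monoid $S$ such that (O1) every increasing sequence in $S$ has a supremum; (O2) every element is the supremum of a $\ll$-increasing sequence; (O3) $x'\ll x$ and $y'\ll y$ imply $x'+y'\ll x+y$; (O4) $\sup_n(x_n+y_n)=\sup_n x_n+\sup_n y_n$ for increasing sequences $(x_n)_n$, $(y_n)_n$. A $\mathrm{Cu}$-morphism is a $\mathrm{PoM}$-morphism preserving $\ll$ and suprema of increasing sequences. An element $x$ is compact if $x\ll x$, and $S_c$ denotes the positively ordered monoid of compact elements of $S$. Products and inductive limits of $\mathrm{Cu}$-semigroups are taken in the category $\mathrm{Cu}$. In a category with products and inductive limits, the ultraproduct of $(X_j)_{j\in J}$ along an ultrafilter $\mathcal U$ on $J$ is $\prod_{\mathcal U}X_j:=\varinjlim_{F\in\mathcal U}\prod_{j\in F}X_j$, where $\mathcal U$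 is ordered by reverse inclusion, and $\pi_{\mathcal U}\colon\prod_{j\in J}X_j\to\prod_{\mathcal U}X_j$ is the natural morphism. (1) Let $(S_j)_{j\in J}$ be a family of $\mathrm{Cu}$-semigroups, with product projections $\pi_i\colon\prod_{j\in J}S_j\to S_i$. The map $y\mapsto(\pi_j(y))_{j\in J}$ is a $\mathrm{PoM}$-isomorphism from $\big(\prod_{j\in J}S_j\big)_c$ onto the set-theoretic product of the $(S_j)_c$ with componentwise addition and order. (2) Let $\mathcal U$ be an ultrafilter on a set $J$. For families $(S_j)_{j\in J}$ of $\mathrm{Cu}$-semigroups there are $\mathrm{PoM}$-isomorphisms \[ \Big(\prod_{\mathcal U}S_j\Big)_c\;\cong\;\prod_{\mathcal U}(S_j)_c , \] the ultraproduct on the right being taken in $\mathrm{PoM}$. They are natural with respect to families of $\mathrm{Cu}$-morphisms $S_j\to T_j$ and compatible, for every $F\in\mathcal U$, with the canonical maps from $\big(\prod_{j\in F}S_j\big)_c$ and $\prod_{j\in F}(S_j)_c$ into the two sides and the map $y\mapsto(\pi_j(y))_{j\in F}$. (3) In the situation of (2), for every compact $x\in\prod_{\mathcal U}S_j$ there is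 a compact $y\in\prod_{j\in J}S_j$ with $\pi_{\mathcal U}(y)=x$. -/

import Mathlib

open CategoryTheory CategoryTheory.Limits

universe u

namespace Cuntz

/-! ### Positively ordered monoids, the way-below relation, and Cu-semigroups -/

/-- The (sequential) way-below relation on a partially ordered set. -/
def WayBelow {X : Type*} [PartialOrder X] (x y : X) : Prop :=
  ∀ (s : ℕ → X) (z : X), Monotone s → IsLUB (Set.range s) z → y ≤ z → ∃ k, x ≤ s k

infix:50 " ≪ " => WayBelow

/-- A positively ordered monoid: the order is translation invariant and `0` is least. -/
class IsPosOrdMonoid (M : Type*) [AddCommMonoid M] [PartialOrder M] : Prop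
    extends IsOrderedAddMonoid M where
  zero_least : ∀ x : M, 0 ≤ x

/-- Abstract Cuntz semigroups. -/
class IsCuSemigroup (S : Type*) [AddCommMonoid S] [PartialOrder S] : Prop
    extends IsPosOrdMonoid S where
  O1 : ∀ s : ℕ → S, Monotone s → ∃ z, IsLUB (Set.range s) z
  O2 : ∀ x : S, ∃ s : ℕ → S, (∀ n, s n ≪ s (n + 1)) ∧ IsLUB (Set.range s) x
  O3 : ∀ x' x y' y : S, x' ≪ x → y' ≪ y → x' + y' ≪ x + y
  O4 : ∀ (s t : ℕ → S) (x y : S), Monotone s → Monotone t →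
    IsLUB (Set.range s) x → IsLUB (Set.range t) y →
    IsLUB (Set.range fun n => s n + t n) (x + y)

/-- The category of positively ordered monoids. -/
structure PoM : Type (u + 1) where
  carrier : Type u
  [addCommMonoid : AddCommMonoid carrier]
  [partialOrder : PartialOrder carrier]
  [isPosOrdMonoid : IsPosOrdMonoid carrier]

/-- The category of Cu-semigroups. -/
structure Cu : Type (u + 1) where
  carrier : Type u
  [addCommMonoid : AddCommMonoid carrier]
  [partialOrder : PartialOrder carrier]
  [isCuSemigroup : IsCuSemigroup carrier]

attribute [instance] PoM.addCommMonoid PoM.partialOrder PoM.isPosOrdMonoid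
attribute [instance] Cu.addCommMonoid Cu.partialOrder Cu.isCuSemigroup

instance : CoeSort PoM.{u} (Type u) := ⟨PoM.carrier⟩
instance : CoeSort Cu.{u} (Type u) := ⟨Cu.carrier⟩

/-- Morphisms of positively ordered monoids preserve addition, zero and the order. -/
@[ext]
structure PoM.Hom (M N : PoM.{u}) where
  hom : M →+o N

/-- Cu-morphisms are morphisms of positively ordered monoids that preserve the way-below relation
and suprema of increasing sequences. -/
@[ext]
structure Cu.Hom (S T : Cu.{u}) where
  hom : S →+o T
  map_wayBelow : ∀ x y : S, x ≪ y → hom x ≪ hom y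
  map_isLUB : ∀ (s : ℕ → S) (z : S), Monotone s → IsLUB (Set.range s) z →
    IsLUB (Set.range fun n => hom (s n)) (hom z)

instance : Category PoM.{u} where
  Hom := PoM.Hom
  id M := ⟨OrderAddMonoidHom.id M⟩
  comp f g := ⟨g.hom.comp f.hom⟩

instance : Category Cu.{u} where
  Hom := Cu.Hom
  id S := ⟨OrderAddMonoidHom.id S, fun _ _ h => h, fun _ _ _ h => h⟩
  comp f g := ⟨g.hom.comp f.hom,
    fun x y h => g.map_wayBelow _ _ (f.map_wayBelow x y h),
    fun s z hs hz => g.map_isLUB _ _ (fun _ _ h => f.hom.monotone' (hs h)) (f.map_isLUB s z hs hz)⟩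

@[ext] theorem PoM.hom_ext {M N : PoM.{u}} {f g : M ⟶ N} (h : ∀ x, f.hom x = g.hom x) : f = g :=
  PoM.Hom.ext (DFunLike.ext _ _ h)

@[ext] theorem Cu.hom_ext {M N : Cu.{u}} {f g : M ⟶ N} (h : ∀ x, f.hom x = g.hom x) : f = g :=
  Cu.Hom.ext (DFunLike.ext _ _ h)

@[simp] theorem PoM.id_hom (M : PoM.{u}) (x : M) : PoM.Hom.hom (𝟙 M) x = x := rfl
@[simp] theorem Cu.id_hom (M : Cu.{u}) (x : M) : Cu.Hom.hom (𝟙 M) x = x := rfl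
@[simp] theorem PoM.comp_hom {M N P : PoM.{u}} (f : M ⟶ N) (g : N ⟶ P) (x : M) :
    (f ≫ g).hom x = g.hom (f.hom x) := rfl
@[simp] theorem Cu.comp_hom {M N P : Cu.{u}} (f : M ⟶ N) (g : N ⟶ P) (x : M) :
    (f ≫ g).hom x = g.hom (f.hom x) := rfl

/-! ### Basic facts on the way-below relation -/

section Basic

variable {X : Type*} [PartialOrder X]

theorem WayBelow.le {x y : X} (h : x ≪ y) : x ≤ y := by
  obtain ⟨_, hk⟩ := h (fun _ => y) y monotone_const (by simp) le_rfl
  exact hk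

theorem WayBelow.trans_le {x y z : X} (h : x ≪ y) (h' : y ≤ z) : x ≪ z :=
  fun s w hs hw hz => h s w hs hw (h'.trans hz)

theorem WayBelow.le_trans {x y z : X} (h' : x ≤ y) (h : y ≪ z) : x ≪ z :=
  fun s w hs hw hz => (h s w hs hw hz).imp fun _ hk => h'.trans hk

theorem WayBelow.trans {x y z : X} (h : x ≪ y) (h' : y ≪ z) : x ≪ z := h.trans_le h'.le

theorem monotone_of_wayBelow {s : ℕ → X} (h : ∀ n, s n ≪ s (n + 1)) : Monotone s :=
  monotone_nat_of_le_succ fun n => (h n).le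

variable {S : Type*} [AddCommMonoid S] [PartialOrder S]

theorem zero_wayBelow [IsPosOrdMonoid S] (x : S) : 0 ≪ x :=
  fun s _ _ _ _ => ⟨0, IsPosOrdMonoid.zero_least (s 0)⟩

variable [IsCuSemigroup S]

theorem WayBelow.interp {x y : S} (h : x ≪ y) : ∃ z, x ≪ z ∧ z ≪ y := by
  obtain ⟨s, hs, hy⟩ := IsCuSemigroup.O2 y
  obtain ⟨k, hk⟩ := h s y (monotone_of_wayBelow hs) hy le_rfl
  exact ⟨s (k + 1), WayBelow.le_trans hk (hs k), (hs (k + 1)).trans_le (hy.1 ⟨_, rfl⟩)⟩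

theorem WayBelow.exists_wayBelow {x y : S} (h : x ≪ y) {s : ℕ → S} (hs : Monotone s)
    (hy : IsLUB (Set.range s) y) : ∃ k, x ≪ s k := by
  obtain ⟨z, hxz, hzy⟩ := h.interp
  exact (hzy s y hs hy le_rfl).imp fun _ hk => hxz.trans_le hk

end Basic

/-! ### The compact elements -/

/-- The submonoid of compact elements of a Cu-semigroup. -/
def compactElements (S : Type*) [AddCommMonoid S] [PartialOrder S] [IsCuSemigroup S] :
    AddSubmonoid S where
  carrier := {x | x ≪ x}
  zero_mem' := zero_wayBelow 0
  add_mem' := fun {a b} ha hb => IsCuSemigroup.O3 a a b b ha hb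

instance (S : Type*) [AddCommMonoid S] [PartialOrder S] [IsCuSemigroup S] :
    IsPosOrdMonoid (compactElements S) where
  add_le_add_left := fun _ _ h c => add_le_add_left (α := S) h c
  zero_least := fun x => IsPosOrdMonoid.zero_least (x : S)

/-- The functor sending a Cu-semigroup to its positively ordered monoid of compact elements. -/
def compacts : Cu.{u} ⥤ PoM.{u} where
  obj S := ⟨compactElements S⟩
  map f := ⟨{ toFun := fun x => ⟨f.hom x, f.map_wayBelow _ _ x.2⟩
              map_zero' := Subtype.ext (map_zero f.hom)
              map_add' := fun x y => Subtype.ext (map_add f.hom x.1 y.1)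
              monotone' := fun _ _ h => f.hom.monotone' h }⟩

/-! ### Completion of a monoid with a round relation

Products and directed colimits of Cu-semigroups are both obtained from the following construction:
given a commutative monoid `M` with a transitive, additive relation `r` that interpolates, the
countably generated round ideals of `(M, r)` form a Cu-semigroup. -/

structure IsRound {M : Type*} [AddCommMonoid M] (r : M → M → Prop) : Prop where
  trans : ∀ {x y z}, r x y → r y z → r x z
  zero : ∀ x, r 0 x
  add : ∀ {x x' y y'}, r x x' → r y y' → r (x + y) (x' + y')
  interp : ∀ {x y}, r x y → ∃ z, r x z ∧ r z y

/-- Round ideals that admit a countable cofinal subset. -/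
structure RoundIdeal {M : Type u} [AddCommMonoid M] {r : M → M → Prop} (h : IsRound r) where
  carrier : Set M
  down : ∀ x y, r x y → y ∈ carrier → x ∈ carrier
  directed : ∀ x y, x ∈ carrier → y ∈ carrier → ∃ z ∈ carrier, r x z ∧ r y z
  countable : ∃ t : ℕ → M, (∀ n, t n ∈ carrier) ∧ ∀ x ∈ carrier, ∃ n, r x (t n)

namespace RoundIdeal

variable {M : Type u} [AddCommMonoid M] {r : M → M → Prop} {h : IsRound r}

theorem ext' {I J : RoundIdeal h} (e : I.carrier = J.carrier) : I = J := by
  cases I; cases J; cases e; rfl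

instance : PartialOrder (RoundIdeal h) where
  le I J := I.carrier ⊆ J.carrier
  le_refl I := Set.Subset.refl _
  le_trans I J K := Set.Subset.trans
  le_antisymm I J h₁ h₂ := ext' (Set.Subset.antisymm h₁ h₂)

theorem exists_seq (I : RoundIdeal h) : ∃ u : ℕ → M, (∀ n, u n ∈ I.carrier) ∧
    (∀ n, r (u n) (u (n + 1))) ∧ ∀ x ∈ I.carrier, ∃ n, r x (u n) := by
  obtain ⟨t, ht, hc⟩ := I.countable
  choose z hz hxz hyz using fun x y : I.carrier => I.directed x y x.2 y.2
  let v : ℕ → I.carrier := fun n =>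
    Nat.rec ⟨t 0, ht 0⟩ (fun k c => ⟨z c ⟨t k, ht k⟩, hz _ _⟩) n
  refine ⟨fun n => (v n).1, fun n => (v n).2, fun n => hxz (v n) ⟨t n, ht n⟩, fun x hx => ?_⟩
  obtain ⟨n, hn⟩ := hc x hx
  exact ⟨n + 1, h.trans hn (hyz (v n) ⟨t n, ht n⟩)⟩

/-- The ideal generated by an `r`-increasing sequence. -/
def ofSeq (h : IsRound r) (u : ℕ → M) (hu : ∀ n, r (u n) (u (n + 1))) : RoundIdeal h where
  carrier := {x | ∃ n, r x (u n)}
  down := fun x y hxy ⟨n, hn⟩ => ⟨n, h.trans hxy hn⟩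
  directed := by
    have key : ∀ m n, m ≤ n → ∀ x, r x (u m) → r x (u n) := by
      intro m n hmn x hx
      induction hmn with
      | refl => exact hx
      | step _ ih => exact h.trans ih (hu _)
    rintro x y ⟨m, hm⟩ ⟨n, hn⟩
    exact ⟨u (max m n), ⟨_, hu _⟩, key _ _ (le_max_left m n) _ hm, key _ _ (le_max_right m n) _ hn⟩
  countable := ⟨u, fun n => ⟨n + 1, hu n⟩, fun _ hx => hx⟩

instance : Zero (RoundIdeal h) where
  zero := ofSeq h (fun _ => 0) fun _ => h.zero 0

instance : Add (RoundIdeal h) where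
  add I J :=
    { carrier := {x | ∃ a ∈ I.carrier, ∃ b ∈ J.carrier, r x (a + b)}
      down := fun x y hxy ⟨a, ha, b, hb, hy⟩ => ⟨a, ha, b, hb, h.trans hxy hy⟩
      directed := by
        rintro x y ⟨a, ha, b, hb, hx⟩ ⟨a', ha', b', hb', hy⟩
        obtain ⟨c, hc, hac, hac'⟩ := I.directed a a' ha ha'
        obtain ⟨d, hd, hbd, hbd'⟩ := J.directed b b' hb hb'
        obtain ⟨c', hc', hcc, -⟩ := I.directed c c hc hc
        obtain ⟨d', hd', hdd, -⟩ := J.directed d d hd hd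
        exact ⟨c + d, ⟨c', hc', d', hd', h.add hcc hdd⟩, h.trans hx (h.add hac hbd),
          h.trans hy (h.add hac' hbd')⟩
      countable := by
        obtain ⟨u, hu, hu', hI⟩ := I.exists_seq
        obtain ⟨v, hv, hv', hJ⟩ := J.exists_seq
        have hs := fun n => h.add (hu' n) (hv' n)
        refine ⟨fun n => u n + v n, fun n => ⟨_, hu (n + 1), _, hv (n + 1), hs n⟩, ?_⟩
        rintro x ⟨a, ha, b, hb, hx⟩
        obtain ⟨m, hm⟩ := hI a ha
        obtain ⟨n, hn⟩ := hJ b hb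
        have key : ∀ {w : ℕ → M} (_ : ∀ n, r (w n) (w (n + 1))) (m n), m ≤ n →
            ∀ x, r x (w m) → r x (w n) := by
          intro w hw m n hmn x hx
          induction hmn with
          | refl => exact hx
          | step _ ih => exact h.trans ih (hw _)
        exact ⟨max m n, h.trans hx (h.add (key hu' _ _ (le_max_left m n) _ hm)
          (key hv' _ _ (le_max_right m n) _ hn))⟩ }

theorem le_def {I J : RoundIdeal h} : I ≤ J ↔ ∀ x ∈ I.carrier, x ∈ J.carrier := Iff.rfl

theorem mem_add {I J : RoundIdeal h} {x : M} :
    x ∈ (I + J).carrier ↔ ∃ a ∈ I.carrier, ∃ b ∈ J.carrier, r x (a + b) := Iff.rfl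

theorem mem_zero {x : M} : x ∈ (0 : RoundIdeal h).carrier ↔ r x 0 :=
  ⟨fun ⟨_, hn⟩ => hn, fun hx => ⟨0, hx⟩⟩

theorem exists_above (I : RoundIdeal h) {x : M} (hx : x ∈ I.carrier) :
    ∃ y ∈ I.carrier, r x y := by
  obtain ⟨z, hz, hxz, -⟩ := I.directed x x hx hx
  exact ⟨z, hz, hxz⟩

theorem zero_mem (I : RoundIdeal h) : 0 ∈ I.carrier := by
  obtain ⟨t, ht, -⟩ := I.countable
  exact I.down _ _ (h.zero (t 0)) (ht 0)

theorem add_mem {I J : RoundIdeal h} {x y : M} (hx : x ∈ I.carrier) (hy : y ∈ J.carrier) :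
    x + y ∈ (I + J).carrier := by
  obtain ⟨a, ha, hxa⟩ := I.exists_above hx
  obtain ⟨b, hb, hyb⟩ := J.exists_above hy
  exact ⟨a, ha, b, hb, h.add hxa hyb⟩

theorem add_mono {I I' J J' : RoundIdeal h} (h₁ : I ≤ I') (h₂ : J ≤ J') : I + J ≤ I' + J' :=
  fun _ ⟨a, ha, b, hb, hx⟩ => ⟨a, h₁ ha, b, h₂ hb, hx⟩

theorem add_comm' (I J : RoundIdeal h) : I + J = J + I := by
  apply ext'
  ext x
  constructor <;> rintro ⟨a, ha, b, hb, hx⟩ <;> exact ⟨b, hb, a, ha, add_comm a b ▸ hx⟩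

theorem zero_add' (I : RoundIdeal h) : 0 + I = I := by
  apply ext'
  ext x
  constructor
  · rintro ⟨a, ha, b, hb, hx⟩
    obtain ⟨c, hc, hbc⟩ := I.exists_above hb
    refine I.down _ _ (h.trans hx (h.add (mem_zero.1 ha) hbc)) ?_
    rwa [zero_add]
  · intro hx
    obtain ⟨c, hc, hxc⟩ := I.exists_above hx
    exact ⟨0, zero_mem _, c, hc, (zero_add c).symm ▸ hxc⟩

theorem add_assoc_le (I J K : RoundIdeal h) : I + J + K ≤ I + (J + K) := by
  rintro x ⟨a, ⟨i, hi, j, hj, ha⟩, k, hk, hx⟩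
  obtain ⟨k', hk', hkk⟩ := K.exists_above hk
  exact ⟨i, hi, j + k', add_mem hj hk', add_assoc i j k' ▸ h.trans hx (h.add ha hkk)⟩

instance : AddCommMonoid (RoundIdeal h) where
  add_assoc I J K := by
    apply le_antisymm (add_assoc_le I J K)
    calc I + (J + K) = K + J + I := by rw [add_comm' I, add_comm' J]
      _ ≤ K + (J + I) := add_assoc_le K J I
      _ = I + J + K := by rw [add_comm' K, add_comm' J]
  zero_add := zero_add'
  add_zero I := by rw [add_comm', zero_add']
  add_comm := add_comm'
  nsmul := nsmulRec

instance : IsPosOrdMonoid (RoundIdeal h) where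
  add_le_add_left _ _ hIJ _ := add_mono hIJ le_rfl
  zero_least I := fun _ hx => I.down _ _ (mem_zero.1 hx) I.zero_mem

/-- The union of an increasing sequence of round ideals. -/
def iUnion (s : ℕ → RoundIdeal h) (hs : Monotone s) : RoundIdeal h where
  carrier := {x | ∃ n, x ∈ (s n).carrier}
  down := fun x y hxy ⟨n, hn⟩ => ⟨n, (s n).down x y hxy hn⟩
  directed := by
    rintro x y ⟨m, hm⟩ ⟨n, hn⟩
    obtain ⟨z, hz, hz'⟩ := (s (max m n)).directed x y (hs (le_max_left m n) hm)
      (hs (le_max_right m n) hn)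
    exact ⟨z, ⟨_, hz⟩, hz'⟩
  countable := by
    choose t ht ht' using fun n => (s n).countable
    refine ⟨fun k => t k.unpair.1 k.unpair.2, fun k => ⟨_, ht _ _⟩, ?_⟩
    rintro x ⟨n, hn⟩
    obtain ⟨m, hm⟩ := ht' n x hn
    exact ⟨Nat.pair n m, by simpa using hm⟩

theorem isLUB_iUnion (s : ℕ → RoundIdeal h) (hs : Monotone s) :
    IsLUB (Set.range s) (iUnion s hs) := by
  constructor
  · rintro _ ⟨n, rfl⟩ x hx
    exact ⟨n, hx⟩
  · rintro J hJ x ⟨n, hn⟩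
    exact hJ ⟨n, rfl⟩ hn

theorem isLUB_iff {s : ℕ → RoundIdeal h} (hs : Monotone s) {I : RoundIdeal h} :
    IsLUB (Set.range s) I ↔ ∀ x, x ∈ I.carrier ↔ ∃ n, x ∈ (s n).carrier := by
  constructor
  · intro hI x
    rw [hI.unique (isLUB_iUnion s hs)]
    rfl
  · intro hI
    have : I = iUnion s hs := ext' (Set.ext hI)
    exact this ▸ isLUB_iUnion s hs

theorem wayBelow_of {I J : RoundIdeal h} {y : M} (hy : y ∈ J.carrier)
    (hI : ∀ x ∈ I.carrier, r x y) : I ≪ J := by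
  intro s z hs hz hJ
  obtain ⟨n, hn⟩ := ((isLUB_iff hs).1 hz y).1 (hJ hy)
  exact ⟨n, fun x hx => (s n).down _ _ (hI x hx) hn⟩

theorem exists_approx (J : RoundIdeal h) : ∃ (s : ℕ → RoundIdeal h) (u : ℕ → M),
    (∀ n, s n ≪ s (n + 1)) ∧ IsLUB (Set.range s) J ∧ (∀ n, u n ∈ J.carrier) ∧
    ∀ n, ∀ x ∈ (s n).carrier, r x (u n) := by
  obtain ⟨u, hu, hu', hc⟩ := J.exists_seq
  have step : ∀ n, ∃ K : RoundIdeal h, u n ∈ K.carrier ∧ ∀ x ∈ K.carrier, r x (u (n + 1)) := by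
    intro n
    choose z hz hz' using fun p : {p : M // r p (u (n + 1))} => h.interp p.2
    let v : ℕ → {p : M // r p (u (n + 1))} := fun k =>
      Nat.rec ⟨u n, hu' n⟩ (fun _ p => ⟨z p, hz' p⟩) k
    have hv : ∀ k, r (v k).1 (v (k + 1)).1 := fun k => hz (v k)
    exact ⟨ofSeq h (fun k => (v k).1) hv, ⟨1, hv 0⟩, fun x ⟨k, hk⟩ => h.trans hk (v k).2⟩
  choose s hs hs' using step
  have hww : ∀ n, s n ≪ s (n + 1) := fun n => wayBelow_of (hs (n + 1)) (hs' n)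
  refine ⟨s, fun n => u (n + 1), hww, ?_, fun n => hu _, hs'⟩
  refine (isLUB_iff (monotone_of_wayBelow hww)).2 fun x => ⟨fun hx => ?_, fun ⟨n, hn⟩ => ?_⟩
  · obtain ⟨n, hn⟩ := hc x hx
    exact ⟨n, (s n).down _ _ hn (hs n)⟩
  · exact J.down _ _ (hs' n x hn) (hu _)

theorem wayBelow_iff {I J : RoundIdeal h} :
    I ≪ J ↔ ∃ y ∈ J.carrier, ∀ x ∈ I.carrier, r x y := by
  refine ⟨fun hIJ => ?_, fun ⟨y, hy, hI⟩ => wayBelow_of hy hI⟩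
  obtain ⟨s, u, hs, hJ, hu, hsu⟩ := J.exists_approx
  obtain ⟨n, hn⟩ := hIJ s J (monotone_of_wayBelow hs) hJ le_rfl
  exact ⟨u n, hu n, fun x hx => hsu n x (hn hx)⟩

instance : IsCuSemigroup (RoundIdeal h) where
  O1 s hs := ⟨_, isLUB_iUnion s hs⟩
  O2 J := by
    obtain ⟨s, _, hs, hJ, _⟩ := J.exists_approx
    exact ⟨s, hs, hJ⟩
  O3 I' I J' J hI hJ := by
    obtain ⟨y, hy, hy'⟩ := wayBelow_iff.1 hI
    obtain ⟨z, hz, hz'⟩ := wayBelow_iff.1 hJ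
    exact wayBelow_of (add_mem hy hz) fun x ⟨a, ha, b, hb, hx⟩ =>
      h.trans hx (h.add (hy' a ha) (hz' b hb))
  O4 s t I J hs ht hI hJ := by
    refine (isLUB_iff fun _ _ hmn => add_mono (hs hmn) (ht hmn)).2 fun x => ⟨?_, ?_⟩
    · rintro ⟨a, ha, b, hb, hx⟩
      obtain ⟨m, hm⟩ := ((isLUB_iff hs).1 hI a).1 ha
      obtain ⟨n, hn⟩ := ((isLUB_iff ht).1 hJ b).1 hb
      exact ⟨max m n, a, hs (le_max_left m n) hm, b, ht (le_max_right m n) hn, hx⟩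
    · rintro ⟨n, hn⟩
      exact add_mono (hI.1 ⟨n, rfl⟩) (hJ.1 ⟨n, rfl⟩) hn

/-- A monoid map into a Cu-semigroup that turns `r` into the way-below relation extends to a
Cu-morphism on the completion, sending `I` to the supremum of the image of `I`. -/
theorem exists_extend {T : Type u} [AddCommMonoid T] [PartialOrder T] [IsCuSemigroup T]
    (g : M →+ T) (hg : ∀ x y, r x y → g x ≪ g y) :
    ∃ f : (⟨RoundIdeal h⟩ : Cu.{u}) ⟶ ⟨T⟩, ∀ I : RoundIdeal h,
      IsLUB (g '' I.carrier) (f.hom I) := by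
  have ex : ∀ I : RoundIdeal h, ∃ z, IsLUB (g '' I.carrier) z := by
    intro I
    obtain ⟨u, hu, hu', hc⟩ := I.exists_seq
    obtain ⟨z, hz⟩ := IsCuSemigroup.O1 (fun n => g (u n))
      (monotone_of_wayBelow fun n => hg _ _ (hu' n))
    refine ⟨z, ?_, fun w hw => hz.2 ?_⟩
    · rintro _ ⟨x, hx, rfl⟩
      obtain ⟨n, hn⟩ := hc x hx
      exact (hg _ _ hn).le.trans (hz.1 ⟨n, rfl⟩)
    · rintro _ ⟨n, rfl⟩
      exact hw ⟨_, hu n, rfl⟩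
  choose F hF using ex
  have hmono : Monotone F := fun I J hIJ => (hF I).2 fun _ ⟨x, hx, e⟩ => e ▸ (hF J).1 ⟨x, hIJ hx, rfl⟩
  have hseq : ∀ (I : RoundIdeal h) (u : ℕ → M), (∀ n, u n ∈ I.carrier) →
      (∀ x ∈ I.carrier, ∃ n, r x (u n)) → IsLUB (Set.range fun n => g (u n)) (F I) := by
    intro I u hu hc
    refine ⟨?_, fun w hw => (hF I).2 ?_⟩
    · rintro _ ⟨n, rfl⟩
      exact (hF I).1 ⟨_, hu n, rfl⟩
    · rintro _ ⟨x, hx, rfl⟩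
      obtain ⟨n, hn⟩ := hc x hx
      exact (hg _ _ hn).le.trans (hw ⟨n, rfl⟩)
  refine ⟨⟨{ toFun := F, map_zero' := ?_, map_add' := ?_, monotone' := hmono }, ?_, ?_⟩, hF⟩
  · apply le_antisymm _ (IsPosOrdMonoid.zero_least _)
    refine (hF 0).2 ?_
    rintro _ ⟨x, hx, rfl⟩
    exact map_zero g ▸ (hg _ _ (mem_zero.1 hx)).le
  · intro I J
    change F (I + J) = F I + F J
    apply le_antisymm
    · refine (hF _).2 ?_
      rintro _ ⟨x, ⟨a, ha, b, hb, hx⟩, rfl⟩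
      refine (hg _ _ hx).le.trans ?_
      rw [map_add]
      exact add_le_add ((hF I).1 ⟨a, ha, rfl⟩) ((hF J).1 ⟨b, hb, rfl⟩)
    · obtain ⟨u, hu, hu', hc⟩ := I.exists_seq
      obtain ⟨v, hv, hv', hd⟩ := J.exists_seq
      have := IsCuSemigroup.O4 _ _ _ _ (monotone_of_wayBelow fun n => hg _ _ (hu' n))
        (monotone_of_wayBelow fun n => hg _ _ (hv' n)) (hseq I u hu hc) (hseq J v hv hd)
      refine this.2 ?_
      rintro _ ⟨n, rfl⟩
      change g (u n) + g (v n) ≤ _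
      rw [← map_add]
      exact (hF _).1 ⟨_, add_mem (hu n) (hv n), rfl⟩
  · intro I J hIJ
    obtain ⟨y, hy, hI⟩ := wayBelow_iff.1 hIJ
    obtain ⟨z, hz, hyz⟩ := J.exists_above hy
    refine WayBelow.le_trans ?_ ((hg _ _ hyz).trans_le ((hF J).1 ⟨z, hz, rfl⟩))
    refine (hF I).2 ?_
    rintro _ ⟨x, hx, rfl⟩
    exact (hg _ _ (hI x hx)).le
  · intro s I hs hI
    refine ⟨?_, fun w hw => (hF I).2 ?_⟩
    · rintro _ ⟨n, rfl⟩
      exact hmono (hI.1 ⟨n, rfl⟩)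
    · rintro _ ⟨x, hx, rfl⟩
      obtain ⟨n, hn⟩ := ((isLUB_iff hs).1 hI x).1 hx
      exact ((hF (s n)).1 ⟨x, hn, rfl⟩).trans (hw ⟨n, rfl⟩)

/-- A monoid map out of a Cu-semigroup that turns the way-below relation into `r` induces a
Cu-morphism into the completion. -/
def induce {S : Type u} [AddCommMonoid S] [PartialOrder S] [IsCuSemigroup S] (h : IsRound r)
    (f : S →+ M) (hf : ∀ x y, x ≪ y → r (f x) (f y)) :
    (⟨S⟩ : Cu.{u}) ⟶ ⟨RoundIdeal h⟩ :=
  let F : S → RoundIdeal h := fun t =>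
    { carrier := {x | ∃ t', t' ≪ t ∧ r x (f t')}
      down := fun x y hxy ⟨t', ht', hy⟩ => ⟨t', ht', h.trans hxy hy⟩
      directed := by
        rintro x y ⟨a, ha, hx⟩ ⟨b, hb, hy⟩
        obtain ⟨s, hs, ht⟩ := IsCuSemigroup.O2 t
        have hm := monotone_of_wayBelow hs
        obtain ⟨m, hm'⟩ := ha.exists_wayBelow hm ht
        obtain ⟨n, hn'⟩ := hb.exists_wayBelow hm ht
        have hmax : ∀ k, s k ≪ t := fun k => (hs k).trans_le (ht.1 ⟨_, rfl⟩)
        exact ⟨f (s (max m n)), ⟨s (max m n + 1), hmax _, hf _ _ (hs _)⟩,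
          h.trans hx (hf _ _ (hm'.trans_le (hm (le_max_left m n)))),
          h.trans hy (hf _ _ (hn'.trans_le (hm (le_max_right m n))))⟩
      countable := by
        obtain ⟨s, hs, ht⟩ := IsCuSemigroup.O2 t
        refine ⟨fun n => f (s n), fun n => ⟨s (n + 1), ?_, hf _ _ (hs n)⟩, ?_⟩
        · exact (hs _).trans_le (ht.1 ⟨_, rfl⟩)
        · rintro x ⟨t', ht', hx⟩
          obtain ⟨n, hn⟩ := ht'.exists_wayBelow (monotone_of_wayBelow hs) ht
          exact ⟨n, h.trans hx (hf _ _ hn)⟩ }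
  have hmono : Monotone F := fun _ _ hst _ ⟨t', ht', hx⟩ => ⟨t', ht'.trans_le hst, hx⟩
  ⟨{ toFun := F
     map_zero' := ext' <| Set.ext fun x => by
      rw [mem_zero]
      constructor
      · rintro ⟨t', ht', hx⟩
        exact map_zero f ▸ h.trans hx (hf _ _ ht')
      · intro hx
        exact ⟨0, zero_wayBelow 0, (map_zero f).symm ▸ hx⟩
     map_add' := fun s t => le_antisymm
      (by
        rintro x ⟨w, hw, hx⟩
        obtain ⟨a, ha, hs⟩ := IsCuSemigroup.O2 s
        obtain ⟨b, hb, ht⟩ := IsCuSemigroup.O2 t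
        have ha' := monotone_of_wayBelow ha
        have hb' := monotone_of_wayBelow hb
        obtain ⟨n, hn⟩ := hw.exists_wayBelow (s := fun n => a n + b n)
          (fun _ _ hmn => add_le_add (ha' hmn) (hb' hmn)) (IsCuSemigroup.O4 a b s t ha' hb' hs ht)
        have hr := h.trans hx (hf _ _ hn)
        rw [map_add] at hr
        exact ⟨f (a n), ⟨a (n + 1), (ha _).trans_le (hs.1 ⟨_, rfl⟩), hf _ _ (ha n)⟩,
          f (b n), ⟨b (n + 1), (hb _).trans_le (ht.1 ⟨_, rfl⟩), hf _ _ (hb n)⟩, hr⟩)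
      (by
        rintro x ⟨a, ⟨s', hs', ha⟩, b, ⟨t', ht', hb⟩, hx⟩
        refine ⟨s' + t', IsCuSemigroup.O3 _ _ _ _ hs' ht', ?_⟩
        rw [map_add]
        exact h.trans hx (h.add ha hb))
     monotone' := hmono },
   fun s t hst => by
    obtain ⟨w, hsw, hwt⟩ := hst.interp
    obtain ⟨w', hww, hwt'⟩ := hwt.interp
    exact wayBelow_of (y := f w) ⟨w', hwt', hf _ _ hww⟩
      fun x ⟨t', ht', hx⟩ => h.trans hx (hf _ _ (ht'.trans hsw)),
   fun s t hs ht => by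
    refine (isLUB_iff fun _ _ hmn => hmono (hs hmn)).2 fun x => ⟨?_, ?_⟩
    · rintro ⟨w, hw, hx⟩
      obtain ⟨n, hn⟩ := hw.exists_wayBelow hs ht
      exact ⟨n, w, hn, hx⟩
    · rintro ⟨n, hn⟩
      exact hmono (ht.1 ⟨n, rfl⟩) hn⟩

theorem mem_induce {S : Type u} [AddCommMonoid S] [PartialOrder S] [IsCuSemigroup S]
    (f : S →+ M) (hf : ∀ x y, x ≪ y → r (f x) (f y)) (t : S) (x : M) :
    x ∈ (((induce h f hf).hom t : RoundIdeal h)).carrier ↔ ∃ t', t' ≪ t ∧ r x (f t') := Iff.rfl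

end RoundIdeal

/-! ### Products -/

section Products

variable {J : Type u}

theorem isRound_pi (S : J → Cu.{u}) :
    IsRound (M := ∀ j, S j) (fun x y => ∀ j, x j ≪ y j) where
  trans hxy hyz j := (hxy j).trans (hyz j)
  zero x j := zero_wayBelow (x j)
  add hx hy j := IsCuSemigroup.O3 _ _ _ _ (hx j) (hy j)
  interp hxy := by
    choose z hz hz' using fun j => (hxy j).interp
    exact ⟨z, hz, hz'⟩

theorem exists_piProj (S : J → Cu.{u}) (j : J) :
    ∃ f : (⟨RoundIdeal (isRound_pi S)⟩ : Cu.{u}) ⟶ S j, ∀ I : RoundIdeal (isRound_pi S),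
      IsLUB ((fun x : ∀ j, S j => x j) '' I.carrier) (f.hom I) :=
  RoundIdeal.exists_extend (Pi.evalAddMonoidHom (fun j => (S j : Type u)) j) fun _ _ hxy => hxy j

/-- A product cone in the category of Cu-semigroups. -/
noncomputable def cuFan (S : J → Cu.{u}) : Fan S :=
  Fan.mk (⟨RoundIdeal (isRound_pi S)⟩ : Cu.{u}) fun j => (exists_piProj S j).choose

theorem cuFan_proj (S : J → Cu.{u}) (j : J) (I : RoundIdeal (isRound_pi S)) :
    IsLUB ((fun x : ∀ j, S j => x j) '' I.carrier) (((cuFan S).proj j).hom I) :=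
  (exists_piProj S j).choose_spec I

theorem cuFan_ext_aux (S : J → Cu.{u}) {T : Cu.{u}} (f g : T ⟶ (cuFan S).pt)
    (hfg : ∀ j, f ≫ (cuFan S).proj j = g ≫ (cuFan S).proj j) (t : T) :
    f.hom t ≤ g.hom t := by
  obtain ⟨s, hs, ht⟩ := IsCuSemigroup.O2 t
  have hm := monotone_of_wayBelow hs
  refine (f.map_isLUB s t hm ht).2 ?_
  rintro _ ⟨n, rfl⟩
  obtain ⟨y, hy, hy'⟩ := (RoundIdeal.wayBelow_iff (h := isRound_pi S)).1
    (f.map_wayBelow _ _ (hs n))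
  obtain ⟨z, hz, hz'⟩ := (RoundIdeal.wayBelow_iff (h := isRound_pi S)).1
    (g.map_wayBelow _ _ (hs (n + 1)))
  have key : ∀ j, y j ≤ z j := fun j => by
    have h₁ : y j ≤ ((cuFan S).proj j).hom (f.hom (s (n + 1))) :=
      (cuFan_proj S j _).1 ⟨y, hy, rfl⟩
    have h₂ : ((cuFan S).proj j).hom (f.hom (s (n + 1))) =
        ((cuFan S).proj j).hom (g.hom (s (n + 1))) :=
      congrArg (fun k : T ⟶ S j => k.hom (s (n + 1))) (hfg j)
    rw [h₂] at h₁
    refine h₁.trans ((cuFan_proj S j _).2 ?_)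
    rintro _ ⟨x, hx, rfl⟩
    exact (hz' x hx j).le
  intro x hx
  have hg : g.hom (s (n + 1 + 1)) ≤ g.hom t := g.hom.monotone' (ht.1 ⟨_, rfl⟩)
  exact hg (RoundIdeal.down _ x z (fun j => (hy' x hx j).trans_le (key j)) hz)

/-- The Cu-morphism into the product that is induced by a cone. -/
def cuFanLift (S : J → Cu.{u}) (c : Fan S) : c.pt ⟶ (cuFan S).pt :=
  RoundIdeal.induce (isRound_pi S)
    { toFun := fun t j => (c.proj j).hom t
      map_zero' := funext fun j => map_zero (c.proj j).hom
      map_add' := fun a b => funext fun j => map_add (c.proj j).hom a b }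
    fun x y hxy j => (c.proj j).map_wayBelow x y hxy

theorem cuFanLift_proj (S : J → Cu.{u}) (c : Fan S) (j : J) :
    cuFanLift S c ≫ (cuFan S).proj j = c.proj j := by
  ext t
  refine (cuFan_proj S j _).unique ?_
  obtain ⟨s, hs, ht⟩ := IsCuSemigroup.O2 t
  have hl := (c.proj j).map_isLUB s t (monotone_of_wayBelow hs) ht
  refine ⟨?_, fun w hw => hl.2 ?_⟩
  · rintro _ ⟨x, ⟨t', ht', hx⟩, rfl⟩
    exact (hx j).le.trans ((c.proj j).hom.monotone' ht'.le)
  · rintro _ ⟨n, rfl⟩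
    exact hw ⟨fun i => (c.proj i).hom (s n), ⟨s (n + 1), (hs _).trans_le (ht.1 ⟨_, rfl⟩),
      fun i => (c.proj i).map_wayBelow _ _ (hs n)⟩, rfl⟩

/-- The cone `cuFan S` is a product of the family `S`. -/
noncomputable def cuFanIsLimit (S : J → Cu.{u}) : IsLimit (cuFan S) :=
  Fan.IsLimit.mk _ (fun c => cuFanLift S c) (fun c j => cuFanLift_proj S c j)
    fun c m hm => by
      have e : ∀ j, m ≫ (cuFan S).proj j = cuFanLift S c ≫ (cuFan S).proj j := fun j =>
        (hm j).trans (cuFanLift_proj S c j).symm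
      ext t
      exact le_antisymm (cuFan_ext_aux S _ _ e t) (cuFan_ext_aux S _ _ (fun j => (e j).symm) t)

instance : HasProducts.{u} Cu.{u} := hasProducts_of_limit_fans _ fun _ => cuFanIsLimit _

/-- The product in the category of positively ordered monoids: the set-theoretic product with
componentwise addition and order. -/
def pomFan (M : J → PoM.{u}) : Fan M :=
  Fan.mk
    (@PoM.mk (∀ j, M j) _ _
      { add_le_add_left := fun _ _ hxy z j => add_le_add_left (hxy j) (z j)
        zero_least := fun x j => IsPosOrdMonoid.zero_least (x j) })
    fun j => ⟨{ toFun := fun x => x j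
                map_zero' := rfl
                map_add' := fun _ _ => rfl
                monotone' := fun _ _ hxy => hxy j }⟩

/-- The cone `pomFan M` is a product of the family `M`. -/
def pomFanIsLimit (M : J → PoM.{u}) : IsLimit (pomFan M) :=
  Fan.IsLimit.mk _
    (fun c => ⟨{ toFun := fun t j => (c.proj j).hom t
                 map_zero' := funext fun j => map_zero (c.proj j).hom
                 map_add' := fun a b => funext fun j => map_add (c.proj j).hom a b
                 monotone' := fun _ _ hab j => (c.proj j).hom.monotone' hab }⟩)
    (fun _ _ => rfl)
    fun c m hm => by
      ext t
      exact funext fun j => congrArg (fun k : c.pt ⟶ M j => k.hom t) (hm j)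

instance : HasProducts.{u} PoM.{u} := hasProducts_of_limit_fans _ fun _ => pomFanIsLimit _

end Products

/-! ### Directed colimits -/

section Colimits

variable {I : Type u} [Preorder I]

/-- The connecting maps of a directed system of positively ordered monoids. -/
def pomSys (K : I ⥤ PoM.{u}) (i j : I) (hij : i ≤ j) : K.obj i →+o K.obj j :=
  (K.map (homOfLE hij)).hom

instance (K : I ⥤ PoM.{u}) :
    DirectedSystem (fun i => (K.obj i : Type u)) (fun i j hij => pomSys K i j hij) where
  map_self i x := by
    change (K.map (𝟙 i)).hom x = x
    rw [K.map_id]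
    rfl
  map_map k j i hij hjk x := by
    change (K.map (homOfLE hij) ≫ K.map (homOfLE hjk)).hom x = _
    rw [← K.map_comp]
    rfl

theorem pomSys_trans (K : I ⥤ PoM.{u}) {i j k : I} (hij : i ≤ j) (hjk : j ≤ k) (x : K.obj i) :
    pomSys K j k hjk (pomSys K i j hij x) = pomSys K i k (hij.trans hjk) x :=
  DirectedSystem.map_map' (pomSys K) hij hjk x

variable [IsDirectedOrder I] [Nonempty I]

/-- The direct limit of a directed system of positively ordered monoids. -/
def PomLim (K : I ⥤ PoM.{u}) : Type u :=
  DirectLimit (fun i => (K.obj i : Type u)) (pomSys K)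

noncomputable instance (K : I ⥤ PoM.{u}) : AddCommMonoid (PomLim K) :=
  inferInstanceAs (AddCommMonoid (DirectLimit (fun i => (K.obj i : Type u)) (pomSys K)))

/-- The map into the direct limit. -/
def pomOf (K : I ⥤ PoM.{u}) (i : I) : K.obj i →+ PomLim K where
  toFun x := (⟦⟨i, x⟩⟧ : DirectLimit (fun i => (K.obj i : Type u)) (pomSys K))
  map_zero' := (DirectLimit.zero_def (f := pomSys K) i).symm
  map_add' x y := (DirectLimit.add_def (f := pomSys K) i x y).symm

theorem pomOf_map (K : I ⥤ PoM.{u}) {i j : I} (hij : i ≤ j) (x : K.obj i) :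
    pomOf K j (pomSys K i j hij x) = pomOf K i x :=
  (Quotient.sound (DirectLimit.r_of_le (pomSys K) (⟨i, x⟩ : Σ i, (K.obj i : Type u)) j hij)).symm

theorem exists_pomOf (K : I ⥤ PoM.{u}) (x : PomLim K) : ∃ i a, x = pomOf K i a :=
  DirectLimit.exists_eq_mk (pomSys K) x

theorem exists_pomOf₂ (K : I ⥤ PoM.{u}) (x y : PomLim K) :
    ∃ i a b, x = pomOf K i a ∧ y = pomOf K i b :=
  DirectLimit.exists_eq_mk₂ (pomSys K) x y

theorem pomOf_eq (K : I ⥤ PoM.{u}) {i j : I} {a : K.obj i} {b : K.obj j}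
    (e : pomOf K i a = pomOf K j b) : ∃ k, ∃ hik : i ≤ k, ∃ hjk : j ≤ k,
      pomSys K i k hik a = pomSys K j k hjk b :=
  Quotient.exact e

/-- One element of the direct limit is below another if this holds for some representatives. -/
instance (K : I ⥤ PoM.{u}) : LE (PomLim K) where
  le x y := ∃ i, ∃ a b : K.obj i, a ≤ b ∧ x = pomOf K i a ∧ y = pomOf K i b

theorem pomOf_le (K : I ⥤ PoM.{u}) {x : PomLim K} {i : I} {c : K.obj i}
    (hx : x ≤ pomOf K i c) :
    ∃ j, ∃ hij : i ≤ j, ∃ a : K.obj j, x = pomOf K j a ∧ a ≤ pomSys K i j hij c := by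
  obtain ⟨k, a, b, hab, rfl, e⟩ := hx
  obtain ⟨l, hil, hkl, e⟩ := pomOf_eq K e
  exact ⟨l, hil, pomSys K k l hkl a, (pomOf_map K _ a).symm, e ▸ (pomSys K k l hkl).monotone' hab⟩

instance (K : I ⥤ PoM.{u}) : PartialOrder (PomLim K) where
  le_refl x := by
    obtain ⟨i, a, rfl⟩ := exists_pomOf K x
    exact ⟨i, a, a, le_rfl, rfl, rfl⟩
  le_trans := by
    rintro x y _ hxy ⟨i, b, c, hbc, rfl, rfl⟩
    obtain ⟨j, hij, a, rfl, hab⟩ := pomOf_le K hxy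
    exact ⟨j, a, _, hab.trans ((pomSys K i j hij).monotone' hbc), rfl, (pomOf_map K hij c).symm⟩
  le_antisymm := by
    rintro _ y ⟨i, a, b, hab, rfl, rfl⟩ hyx
    obtain ⟨j, hij, c, e, hca⟩ := pomOf_le K hyx
    obtain ⟨k, hik, hjk, e⟩ := pomOf_eq K e
    have hba : pomSys K i k hik b ≤ pomSys K i k hik a := by
      rw [e, ← pomSys_trans K hij hjk]
      exact (pomSys K j k hjk).monotone' hca
    have hba' := le_antisymm ((pomSys K i k hik).monotone' hab) hba
    exact (pomOf_map K hik a).symm.trans ((congrArg (pomOf K k) hba').trans (pomOf_map K hik b))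

instance (K : I ⥤ PoM.{u}) : IsPosOrdMonoid (PomLim K) where
  add_le_add_left := by
    rintro _ _ ⟨i, a, b, hab, rfl, rfl⟩ z
    obtain ⟨j, c, rfl⟩ := exists_pomOf K z
    obtain ⟨k, hik, hjk⟩ := exists_ge_ge i j
    refine ⟨k, _, _, add_le_add_left ((pomSys K i k hik).monotone' hab) (pomSys K j k hjk c),
      ?_, ?_⟩
    · rw [map_add]
      exact congrArg₂ _ (pomOf_map K hik a).symm (pomOf_map K hjk c).symm
    · rw [map_add]
      exact congrArg₂ _ (pomOf_map K hik b).symm (pomOf_map K hjk c).symm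
  zero_least x := by
    obtain ⟨i, a, rfl⟩ := exists_pomOf K x
    exact ⟨i, 0, a, IsPosOrdMonoid.zero_least a, (map_zero (pomOf K i)).symm, rfl⟩

/-- A colimit cocone of a directed system of positively ordered monoids. -/
noncomputable def pomCocone (K : I ⥤ PoM.{u}) : Cocone K where
  pt := ⟨PomLim K⟩
  ι :=
    { app := fun i => ⟨{ pomOf K i with monotone' := fun a b hab => ⟨i, a, b, hab, rfl, rfl⟩ }⟩
      naturality := fun _ _ f => PoM.hom_ext fun a => pomOf_map K (leOfHom f) a }

/-- The map out of the direct limit that is induced by a cocone. -/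
def pomDescFun (K : I ⥤ PoM.{u}) (c : Cocone K) : PomLim K → c.pt :=
  DirectLimit.lift (pomSys K) (fun i x => (c.ι.app i).hom x) fun _ _ hij x =>
    (congrArg (fun k : _ ⟶ c.pt => k.hom x) (c.w (homOfLE hij))).symm

/-- The morphism out of the direct limit that is induced by a cocone. -/
noncomputable def pomDesc (K : I ⥤ PoM.{u}) (c : Cocone K) : (pomCocone K).pt ⟶ c.pt where
  hom :=
    { toFun := pomDescFun K c
      map_zero' := by
        obtain ⟨i⟩ := ‹Nonempty I›
        exact (congrArg (pomDescFun K c) (map_zero (pomOf K i)).symm).trans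
          (map_zero (c.ι.app i).hom)
      map_add' := fun x y => by
        obtain ⟨i, a, b, rfl, rfl⟩ := exists_pomOf₂ K x y
        exact (congrArg (pomDescFun K c) (map_add (pomOf K i) a b).symm).trans
          (map_add (c.ι.app i).hom a b)
      monotone' := by
        rintro _ _ ⟨i, a, b, hab, rfl, rfl⟩
        exact (c.ι.app i).hom.monotone' hab }

/-- The cocone `pomCocone K` is a colimit. -/
noncomputable def pomCoconeIsColimit (K : I ⥤ PoM.{u}) : IsColimit (pomCocone K) where
  desc c := pomDesc K c
  fac _ _ := rfl
  uniq c _ hm := PoM.hom_ext fun x => by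
    obtain ⟨i, a, rfl⟩ := exists_pomOf K x
    exact congrArg (fun k : K.obj i ⟶ c.pt => k.hom a) (hm i)

instance : HasColimitsOfShape I PoM.{u} where
  has_colimit K := ⟨⟨⟨pomCocone K, pomCoconeIsColimit K⟩⟩⟩

/-- The forgetful functor from Cu-semigroups to positively ordered monoids. -/
def forgetCu : Cu.{u} ⥤ PoM.{u} where
  obj S := ⟨S⟩
  map f := ⟨f.hom⟩

/-- The algebraic direct limit of a directed system of Cu-semigroups. -/
abbrev CuAlgLim (K : I ⥤ Cu.{u}) : Type u := PomLim (K ⋙ forgetCu)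

/-- The map into the algebraic direct limit. -/
noncomputable abbrev cuAlgOf (K : I ⥤ Cu.{u}) (i : I) : K.obj i →+ CuAlgLim K :=
  pomOf (K ⋙ forgetCu) i

/-- The connecting maps of a directed system of Cu-semigroups. -/
abbrev cuSys (K : I ⥤ Cu.{u}) (i j : I) (hij : i ≤ j) : K.obj i →+o K.obj j :=
  (K.map (homOfLE hij)).hom

theorem cuAlgOf_map (K : I ⥤ Cu.{u}) {i j : I} (hij : i ≤ j) (x : K.obj i) :
    cuAlgOf K j (cuSys K i j hij x) = cuAlgOf K i x :=
  pomOf_map (K ⋙ forgetCu) hij x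

/-- The relation induced by the way-below relations on the algebraic direct limit. -/
def cuAlgRel (K : I ⥤ Cu.{u}) (x y : CuAlgLim K) : Prop :=
  ∃ i, ∃ a b : K.obj i, a ≪ b ∧ x = cuAlgOf K i a ∧ y = cuAlgOf K i b

theorem cuAlgRel_later (K : I ⥤ Cu.{u}) {x : CuAlgLim K} {i : I} {c : K.obj i}
    (hx : cuAlgRel K x (cuAlgOf K i c)) (i₀ : I) :
    ∃ j, ∃ hij : i ≤ j, i₀ ≤ j ∧ ∃ a : K.obj j, x = cuAlgOf K j a ∧ a ≪ cuSys K i j hij c := by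
  obtain ⟨k, a, b, hab, rfl, e⟩ := hx
  obtain ⟨l, hil, hkl, e⟩ := pomOf_eq (K ⋙ forgetCu) e
  obtain ⟨m, hlm, him⟩ := exists_ge_ge l i₀
  refine ⟨m, hil.trans hlm, him, cuSys K k m (hkl.trans hlm) a, (cuAlgOf_map K _ a).symm, ?_⟩
  have e' : cuSys K i m (hil.trans hlm) c = cuSys K k m (hkl.trans hlm) b := by
    exact (pomSys_trans (K ⋙ forgetCu) hil hlm c).symm.trans
      ((congrArg (cuSys K l m hlm) e).trans (pomSys_trans (K ⋙ forgetCu) hkl hlm b))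
  rw [e']
  exact (K.map (homOfLE _)).map_wayBelow _ _ hab

theorem isRound_alg (K : I ⥤ Cu.{u}) : IsRound (cuAlgRel K) where
  trans := by
    rintro x y _ hxy ⟨i, b, c, hbc, rfl, rfl⟩
    obtain ⟨j, hij, -, a, rfl, hab⟩ := cuAlgRel_later K hxy i
    exact ⟨j, a, _, hab.trans ((K.map (homOfLE hij)).map_wayBelow _ _ hbc), rfl,
      (cuAlgOf_map K hij c).symm⟩
  zero := by
    intro x
    obtain ⟨i, x, rfl⟩ := exists_pomOf (K ⋙ forgetCu) x
    exact ⟨i, 0, x, zero_wayBelow x, (map_zero (cuAlgOf K i)).symm, rfl⟩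
  add := by
    rintro _ _ _ _ ⟨i, a, b, hab, rfl, rfl⟩ ⟨j, c, d, hcd, rfl, rfl⟩
    obtain ⟨k, hik, hjk⟩ := exists_ge_ge i j
    refine ⟨k, _, _, IsCuSemigroup.O3 _ _ _ _ ((K.map (homOfLE hik)).map_wayBelow _ _ hab)
      ((K.map (homOfLE hjk)).map_wayBelow _ _ hcd), ?_, ?_⟩
    · rw [map_add]
      exact congrArg₂ _ (cuAlgOf_map K hik a).symm (cuAlgOf_map K hjk c).symm
    · rw [map_add]
      exact congrArg₂ _ (cuAlgOf_map K hik b).symm (cuAlgOf_map K hjk d).symm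
  interp := by
    rintro _ _ ⟨i, a, b, hab, rfl, rfl⟩
    obtain ⟨c, hac, hcb⟩ := hab.interp
    exact ⟨_, ⟨i, a, c, hac, rfl, rfl⟩, ⟨i, c, b, hcb, rfl, rfl⟩⟩

/-- The map from a member of a directed system into the colimit. -/
noncomputable def cuColimι (K : I ⥤ Cu.{u}) (i : I) :
    K.obj i ⟶ (⟨RoundIdeal (isRound_alg K)⟩ : Cu.{u}) :=
  RoundIdeal.induce (isRound_alg K) (cuAlgOf K i) fun x y hxy => ⟨i, x, y, hxy, rfl, rfl⟩

theorem mem_cuColimι (K : I ⥤ Cu.{u}) (i : I) (a : K.obj i) (x : CuAlgLim K) :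
    x ∈ (((cuColimι K i).hom a : RoundIdeal (isRound_alg K))).carrier ↔
      cuAlgRel K x (cuAlgOf K i a) := by
  constructor
  · rintro ⟨b, hb, hx⟩
    exact (isRound_alg K).trans hx ⟨i, b, a, hb, rfl, rfl⟩
  · intro hx
    obtain ⟨j, hij, -, b, rfl, hb⟩ := cuAlgRel_later K hx i
    obtain ⟨s, hs, ha⟩ := IsCuSemigroup.O2 a
    have hm := monotone_of_wayBelow hs
    obtain ⟨n, hn⟩ := hb.exists_wayBelow (fun _ _ hmn => (K.map (homOfLE hij)).hom.monotone' (hm hmn))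
      ((K.map (homOfLE hij)).map_isLUB s a hm ha)
    exact ⟨s n, (hs n).trans_le (ha.1 ⟨_, rfl⟩), j, b, _, hn, rfl, (cuAlgOf_map K hij (s n)).symm⟩

/-- A colimit cocone of a directed system of Cu-semigroups. -/
noncomputable def cuCocone (K : I ⥤ Cu.{u}) : Cocone K where
  pt := ⟨RoundIdeal (isRound_alg K)⟩
  ι :=
    { app := cuColimι K
      naturality := fun i j f => by
        refine Cu.hom_ext fun a => RoundIdeal.ext' (Set.ext fun x => ?_)
        refine (mem_cuColimι K j _ x).trans (Iff.trans ?_ (mem_cuColimι K i a x).symm)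
        exact iff_of_eq (congrArg (cuAlgRel K x) (cuAlgOf_map K (leOfHom f) a)) }

/-- The monoid map out of the algebraic direct limit that is induced by a cocone. -/
noncomputable def cuAlgDesc (K : I ⥤ Cu.{u}) (c : Cocone K) : CuAlgLim K →+ c.pt :=
  (pomDesc (K ⋙ forgetCu) (forgetCu.mapCocone c)).hom.toAddMonoidHom

theorem cuAlgDesc_rel (K : I ⥤ Cu.{u}) (c : Cocone K) (x y : CuAlgLim K) (hxy : cuAlgRel K x y) :
    cuAlgDesc K c x ≪ cuAlgDesc K c y := by
  obtain ⟨i, a, b, hab, rfl, rfl⟩ := hxy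
  exact (c.ι.app i).map_wayBelow _ _ hab

/-- The Cu-morphism out of the colimit that is induced by a cocone. -/
noncomputable def cuColimDesc (K : I ⥤ Cu.{u}) (c : Cocone K) : (cuCocone K).pt ⟶ c.pt :=
  (RoundIdeal.exists_extend (cuAlgDesc K c) (cuAlgDesc_rel K c)).choose

theorem cuColimDesc_isLUB (K : I ⥤ Cu.{u}) (c : Cocone K) (A : RoundIdeal (isRound_alg K)) :
    IsLUB (cuAlgDesc K c '' A.carrier) ((cuColimDesc K c).hom A) :=
  (RoundIdeal.exists_extend (cuAlgDesc K c) (cuAlgDesc_rel K c)).choose_spec A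

theorem cuColimι_desc (K : I ⥤ Cu.{u}) (c : Cocone K) (i : I) :
    cuColimι K i ≫ cuColimDesc K c = c.ι.app i := by
  ext a
  refine (cuColimDesc_isLUB K c _).unique ⟨?_, fun w hw => ?_⟩
  · rintro _ ⟨x, hx, rfl⟩
    exact (cuAlgDesc_rel K c _ _ ((mem_cuColimι K i a x).1 hx)).le
  · obtain ⟨s, hs, ha⟩ := IsCuSemigroup.O2 a
    refine ((c.ι.app i).map_isLUB s a (monotone_of_wayBelow hs) ha).2 ?_
    rintro _ ⟨n, rfl⟩
    exact hw ⟨cuAlgOf K i (s n), (mem_cuColimι K i a _).2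
      ⟨i, _, _, (hs n).trans_le (ha.1 ⟨_, rfl⟩), rfl, rfl⟩, rfl⟩

theorem cuColim_ext (K : I ⥤ Cu.{u}) {T : Cu.{u}} (f g : (cuCocone K).pt ⟶ T)
    (hfg : ∀ i, cuColimι K i ≫ f = cuColimι K i ≫ g) : f = g := by
  refine Cu.hom_ext fun A : RoundIdeal (isRound_alg K) => ?_
  obtain ⟨v, hv, hv', hc⟩ := A.exists_seq
  choose i a e using fun n => (show ∃ i a, v n = cuAlgOf K i a from
    exists_pomOf (K ⋙ forgetCu) (v n))
  have hmono : Monotone fun n => ((cuColimι K (i n)).hom (a n) : RoundIdeal (isRound_alg K)) := by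
    refine monotone_nat_of_le_succ fun n x hx => ?_
    refine (mem_cuColimι K _ _ x).2 ?_
    rw [← e]
    refine (isRound_alg K).trans ((mem_cuColimι K _ _ x).1 hx) ?_
    rw [← e]
    exact hv' n
  have hA : IsLUB (Set.range fun n => ((cuColimι K (i n)).hom (a n) :
      RoundIdeal (isRound_alg K))) A := by
    refine (RoundIdeal.isLUB_iff hmono).2 fun x => ⟨fun hx => ?_, fun ⟨n, hn⟩ => ?_⟩
    · obtain ⟨n, hn⟩ := hc x hx
      refine ⟨n, (mem_cuColimι K _ _ x).2 ?_⟩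
      rwa [← e]
    · have := (mem_cuColimι K _ _ x).1 hn
      rw [← e] at this
      exact A.down _ _ this (hv n)
  have hf := f.map_isLUB _ A hmono hA
  have hg := g.map_isLUB _ A hmono hA
  have : ∀ n, f.hom ((cuColimι K (i n)).hom (a n)) = g.hom ((cuColimι K (i n)).hom (a n)) :=
    fun n => congrArg (fun k : K.obj (i n) ⟶ T => k.hom (a n)) (hfg (i n))
  refine hf.unique ?_
  rw [funext this]
  exact hg

/-- The cocone `cuCocone K` is a colimit. -/
noncomputable def cuCoconeIsColimit (K : I ⥤ Cu.{u}) : IsColimit (cuCocone K) where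
  desc c := cuColimDesc K c
  fac c i := cuColimι_desc K c i
  uniq c _ hm := cuColim_ext K _ _ fun i => (hm i).trans (cuColimι_desc K c i).symm

instance : HasColimitsOfShape I Cu.{u} where
  has_colimit K := ⟨⟨⟨cuCocone K, cuCoconeIsColimit K⟩⟩⟩

end Colimits

/-! ### Categorical ultraproducts -/

section Ultraproduct

variable {J : Type u}

/-- The members of an ultrafilter, ordered by reverse inclusion. -/
abbrev UltraIndex (U : Ultrafilter J) : Type u := {F : Set J // F ∈ U}ᵒᵈ

/-- The member of the ultrafilter that underlies an index. -/
abbrev UltraIndex.set {U : Ultrafilter J} (F : UltraIndex U) : Set J := (OrderDual.ofDual F).1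

instance (U : Ultrafilter J) : IsDirectedOrder (UltraIndex U) where
  directed F G := ⟨OrderDual.toDual ⟨F.set ∩ G.set, Filter.inter_mem F.2 G.2⟩,
    Set.inter_subset_left, Set.inter_subset_right⟩

instance (U : Ultrafilter J) : Nonempty (UltraIndex U) :=
  ⟨OrderDual.toDual ⟨Set.univ, Filter.univ_mem⟩⟩

variable {C : Type*} [Category* C] [HasProducts.{u} C]

/-- The inductive system `F ↦ ∏_{j ∈ F} X j` indexed by the members of `U`, with the morphisms
`∏_{j ∈ F} X j ⟶ ∏_{j ∈ G} X j` for `G ⊆ F` that commute with the projections. -/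
noncomputable def ultraDiagram (U : Ultrafilter J) (X : J → C) : UltraIndex U ⥤ C where
  obj F := ∏ᶜ fun j : F.set => X j
  map {F G} f := Pi.lift fun j : G.set => Pi.π (fun j : F.set => X j) ⟨j, leOfHom f j.2⟩

/-- The ultraproduct of a family of objects: the inductive limit of the products over the members
of the ultrafilter. -/
noncomputable def ultraproduct (U : Ultrafilter J) [HasColimitsOfShape (UltraIndex U) C]
    (X : J → C) : C :=
  colimit (ultraDiagram U X)

/-- The canonical morphism `∏_{j ∈ F} X j ⟶ ∏_U X j` for `F ∈ U`. -/
noncomputable def ultraproductι (U : Ultrafilter J) [HasColimitsOfShape (UltraIndex U) C]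
    (X : J → C) (F : UltraIndex U) : (∏ᶜ fun j : F.set => X j) ⟶ ultraproduct U X :=
  colimit.ι (ultraDiagram U X) F

/-- The natural morphism `∏_j X j ⟶ ∏_U X j`. -/
noncomputable def ultraproductπ (U : Ultrafilter J) [HasColimitsOfShape (UltraIndex U) C]
    (X : J → C) : ∏ᶜ X ⟶ ultraproduct U X :=
  (Pi.lift fun j : (Set.univ : Set J) => Pi.π X j) ≫
    ultraproductι U X (OrderDual.toDual ⟨Set.univ, Filter.univ_mem⟩)

/-- The morphism of inductive systems induced by a family of morphisms. -/
noncomputable def ultraDiagramMap (U : Ultrafilter J) {X Y : J → C} (α : ∀ j, X j ⟶ Y j) :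
    ultraDiagram U X ⟶ ultraDiagram U Y where
  app F := Limits.Pi.map fun j : F.set => α j
  naturality F G f := by
    apply Pi.hom_ext
    intro j
    simp [ultraDiagram]

/-- Functoriality of the ultraproduct. -/
noncomputable def ultraproductMap (U : Ultrafilter J) [HasColimitsOfShape (UltraIndex U) C]
    {X Y : J → C} (α : ∀ j, X j ⟶ Y j) : ultraproduct U X ⟶ ultraproduct U Y :=
  colimMap (ultraDiagramMap U α)

end Ultraproduct

end Cuntz

open Cuntz

namespace Cuntz

/-! ### Compact elements of completions -/

/-! Products and directed colimits in Cu are both completions by countably generated round ideals: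
of the set-theoretic product with componentwise `≪`, and of the algebraic direct limit with
`cuAlgRel`. In such a completion the compact elements are exactly the principal ideals `{x | r x y}`
with `r y y` (`RoundIdeal.compact_iff`), so everything reduces to reading off what `r y y` means.

For a product, `r y y` says that every `y j` is compact, so compact elements of the product are
families of compact elements, ordered componentwise (`pi_compact_le`, `pi_exists_compact`). For a
directed colimit, `r y y` says that `y` has representatives `a ≪ b` at one stage; these become equal
at a later stage, where they give a compact representative. Inequalities between compact elements
also descend to some stage, so `compacts` preserves directed colimits (`preservesColimit_compacts`).

An ultraproduct is a directed colimit of products, so `compacts` commutes with it. The isomorphism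
is assembled from the canonical comparison maps, and compatibility and naturality are checked on the
canonical maps from the stages. For the lifting statement, a compact element of the ultraproduct
comes from a compact element over some `F ∈ U`, whose family of coordinates is extended by the
compact element `0` outside `F`. -/

theorem RoundIdeal.compact_iff {M : Type u} [AddCommMonoid M] {r : M → M → Prop} {h : IsRound r}
    {I : RoundIdeal h} : I ≪ I ↔ ∃ y, r y y ∧ ∀ x, x ∈ I.carrier ↔ r x y := by
  rw [RoundIdeal.wayBelow_iff]
  constructor
  · rintro ⟨y, hy, hI⟩
    -- The bound `y` of `I` lies in `I` itself, hence `r y y`, and `I` is the principal ideal below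
    -- `y`.
    exact ⟨y, hI y hy, fun x => ⟨hI x, fun hx => I.down x y hx hy⟩⟩
  · rintro ⟨y, hy, hI⟩
    exact ⟨y, (hI y).2 hy, fun x hx => (hI x).1 hx⟩

/-- An isomorphism of positively ordered monoids from an order-reflecting surjective morphism. -/
theorem PoM.isIso_of_surjective {M N : PoM.{u}} (f : M ⟶ N)
    (hle : ∀ x y, f.hom x ≤ f.hom y → x ≤ y) (hsurj : Function.Surjective f.hom) : IsIso f := by
  choose g hg using hsurj
  -- Reflecting the order forces injectivity by antisymmetry; the laws for the section `g` are then
  -- verified after applying `f`.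
  have hinj : Function.Injective f.hom := fun x y e => le_antisymm (hle _ _ e.le) (hle _ _ e.ge)
  exact ⟨⟨⟨{ toFun := g
             map_zero' := hinj ((hg 0).trans (map_zero f.hom).symm)
             map_add' := fun a b => hinj (by rw [map_add, hg, hg, hg])
             monotone' := fun a b hab => hle _ _ (by rwa [hg, hg]) }⟩,
    PoM.hom_ext fun x => hinj (hg _), PoM.hom_ext fun x => hg x⟩⟩

/-! ### Compact elements of products -/

section Products

variable {J : Type u} (S : J → Cu.{u})

/-- Since `y` is related to itself it belongs to `I`, so the supremum defining the projection is
attained at `y`. -/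
theorem cuFan_proj_compact {I : RoundIdeal (isRound_pi S)} {y : ∀ j, S j} (hy : ∀ j, y j ≪ y j)
    (hI : ∀ x, x ∈ I.carrier ↔ ∀ j, x j ≪ y j) (j : J) : ((cuFan S).proj j).hom I = y j :=
  (cuFan_proj S j I).unique ⟨by rintro _ ⟨x, hx, rfl⟩; exact ((hI x).1 hx j).le,
    fun _ hw => hw ⟨y, (hI y).2 hy, rfl⟩⟩

/-- Compact ideals are principal, and the projections recover their generators, so the generators
can be compared coordinatewise. For general ideals this fails: projections see only coordinatewise
suprema and forget how uniformly these are approached. -/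
theorem cuFan_compact_le {x y : (cuFan S).pt} (hx : x ≪ x) (hy : y ≪ y)
    (hxy : ∀ j, ((cuFan S).proj j).hom x ≤ ((cuFan S).proj j).hom y) : x ≤ y := by
  obtain ⟨a, ha, hI⟩ := (RoundIdeal.compact_iff (h := isRound_pi S)).1 hx
  obtain ⟨b, hb, hK⟩ := (RoundIdeal.compact_iff (h := isRound_pi S)).1 hy
  intro z hz
  refine (hK z).2 fun j => ((hI z).1 hz j).trans_le ?_
  have := hxy j
  rwa [cuFan_proj_compact S ha hI, cuFan_proj_compact S hb hK] at this

theorem cuFan_exists_compact (y : ∀ j, S j) (hy : ∀ j, y j ≪ y j) :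
    ∃ x : (cuFan S).pt, x ≪ x ∧ ∀ j, ((cuFan S).proj j).hom x = y j := by
  -- Compactness of each `y j` makes the constant sequence `y` increasing for the round relation; it
  -- generates the principal ideal below `y`.
  let I : RoundIdeal (isRound_pi S) := RoundIdeal.ofSeq _ (fun _ => y) fun _ => hy
  have hI : ∀ x, x ∈ I.carrier ↔ ∀ j, x j ≪ y j := fun x => ⟨fun ⟨_, h⟩ => h, fun h => ⟨0, h⟩⟩
  exact ⟨I, RoundIdeal.compact_iff.2 ⟨y, hy, hI⟩, cuFan_proj_compact S hy hI⟩

/-- The comparison of the chosen product with the explicit one. -/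
noncomputable def piIsoCuFan : ∏ᶜ S ≅ (cuFan S).pt :=
  (limit.isLimit (Discrete.functor S)).conePointUniqueUpToIso (cuFanIsLimit S)

theorem piIsoCuFan_inv_π (j : J) : (piIsoCuFan S).inv ≫ Pi.π S j = (cuFan S).proj j :=
  IsLimit.conePointUniqueUpToIso_inv_comp _ _ (⟨j⟩ : Discrete J)

theorem piIsoCuFan_hom_proj (j : J) : (piIsoCuFan S).hom ≫ (cuFan S).proj j = Pi.π S j := by
  rw [← piIsoCuFan_inv_π, Iso.hom_inv_id_assoc]

/-- Transported from the explicit model along `piIsoCuFan`, whose morphisms preserve compactness and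
commute with the projections. Used twice with antisymmetry, this lets compact elements be identified
by their coordinates. -/
theorem pi_compact_le {x y : (∏ᶜ S : Cu.{u})} (hx : x ≪ x) (hy : y ≪ y)
    (hxy : ∀ j, (Pi.π S j).hom x ≤ (Pi.π S j).hom y) : x ≤ y := by
  have key : (piIsoCuFan S).hom.hom x ≤ (piIsoCuFan S).hom.hom y := by
    refine cuFan_compact_le S ((piIsoCuFan S).hom.map_wayBelow _ _ hx)
      ((piIsoCuFan S).hom.map_wayBelow _ _ hy) fun j => ?_
    rw [← Cu.comp_hom, ← Cu.comp_hom, piIsoCuFan_hom_proj]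
    exact hxy j
  have := (piIsoCuFan S).inv.hom.monotone' key
  change (piIsoCuFan S).inv.hom ((piIsoCuFan S).hom.hom x) ≤
    (piIsoCuFan S).inv.hom ((piIsoCuFan S).hom.hom y) at this
  rwa [← Cu.comp_hom, ← Cu.comp_hom, Iso.hom_inv_id] at this

theorem pi_exists_compact (y : ∀ j, S j) (hy : ∀ j, y j ≪ y j) :
    ∃ x : (∏ᶜ S : Cu.{u}), x ≪ x ∧ ∀ j, (Pi.π S j).hom x = y j := by
  obtain ⟨x, hx, hxy⟩ := cuFan_exists_compact S y hy
  refine ⟨(piIsoCuFan S).inv.hom x, (piIsoCuFan S).inv.map_wayBelow _ _ hx, fun j => ?_⟩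
  rw [← Cu.comp_hom, piIsoCuFan_inv_π, hxy]

/-- The compact elements of a product are the families of compact elements. -/
theorem exists_compactElements_pi :
    ∃ e : compactElements (∏ᶜ S : Cu.{u}) ≃+o (∀ j, compactElements (S j)),
      ∀ y j, (e y j : S j) = (Pi.π S j).hom (y : (∏ᶜ S : Cu.{u})) := by
  choose g hg hgπ using fun y : ∀ j, compactElements (S j) =>
    pi_exists_compact S (fun j => y j) fun j => (y j).2
  refine ⟨{ toFun := fun y j => ⟨(Pi.π S j).hom y.1, (Pi.π S j).map_wayBelow _ _ y.2⟩
            invFun := fun y => ⟨g y, hg y⟩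
            -- Equal coordinates suffice for equality here only because both elements are compact.
            left_inv := fun y => Subtype.ext (le_antisymm
              (pi_compact_le S (hg _) y.2 fun j => le_of_eq (hgπ _ j))
              (pi_compact_le S y.2 (hg _) fun j => ge_of_eq (hgπ _ j)))
            right_inv := fun y => funext fun j => Subtype.ext (hgπ y j)
            map_add' := fun x y => funext fun j => Subtype.ext (map_add (Pi.π S j).hom x.1 y.1)
            map_le_map_iff' := fun {x y} => ⟨fun h => pi_compact_le S x.2 y.2 h,
              fun h j => (Pi.π S j).hom.monotone' h⟩ }, fun _ _ => rfl⟩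

/-- The categorical form of the product statement, needed to compare diagrams. The target is
replaced by the explicit product `pomFan`, where the order is componentwise and
`PoM.isIso_of_surjective` applies. -/
instance isIso_piComparison_compacts : IsIso (piComparison compacts S) := by
  let q : compacts.obj (∏ᶜ S) ⟶ (pomFan fun j => compacts.obj (S j)).pt :=
    (pomFanIsLimit fun j => compacts.obj (S j)).lift
      (Fan.mk (compacts.obj (∏ᶜ S)) fun j => compacts.map (Pi.π S j))
  have hq : IsIso q := by
    refine PoM.isIso_of_surjective q (fun x y h => pi_compact_le S x.2 y.2 h) fun y => ?_
    obtain ⟨x, hx, hxy⟩ := pi_exists_compact S (fun j => (y j).1) fun j => (y j).2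
    exact ⟨⟨x, hx⟩, funext fun j => Subtype.ext (hxy j)⟩
  let φ := (limit.isLimit (Discrete.functor fun j => compacts.obj (S j))).conePointUniqueUpToIso
    (pomFanIsLimit fun j => compacts.obj (S j))
  -- Both morphisms have the components `compacts.map (Pi.π S j)`.
  have : piComparison compacts S = q ≫ φ.inv := by
    refine Pi.hom_ext _ _ fun j => ?_
    rw [piComparison_comp_π, Category.assoc]
    have e : φ.inv ≫ Pi.π _ j = (pomFan fun j => compacts.obj (S j)).proj j :=
      IsLimit.conePointUniqueUpToIso_inv_comp _ _ (⟨j⟩ : Discrete J)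
    rw [e]
    rfl
  rw [this]
  infer_instance

end Products

/-! ### Compact elements of directed colimits -/

section Colimits

variable {I : Type u} [Preorder I] [IsDirectedOrder I] [Nonempty I] (K : I ⥤ Cu.{u})

/-- The generator of a compact ideal is the class of both `a` and `b` for some `a ≪ b` at a stage
`i`. Equal classes agree at a later stage `k`, and there the image of `a` is way below itself. -/
theorem cuColim_exists_compact {x : (cuCocone K).pt} (hx : x ≪ x) :
    ∃ i, ∃ a : K.obj i, a ≪ a ∧ ((cuCocone K).ι.app i).hom a = x := by
  obtain ⟨y, ⟨i, a, b, hab, rfl, e⟩, hA⟩ :=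
    (RoundIdeal.compact_iff (h := isRound_alg K)).1 hx
  obtain ⟨k, hik, hik', e⟩ := pomOf_eq (K ⋙ forgetCu) e
  have e : cuSys K i k hik a = cuSys K i k hik b := e
  have hk : cuSys K i k hik a ≪ cuSys K i k hik b := (K.map (homOfLE hik)).map_wayBelow _ _ hab
  rw [← e] at hk
  -- The image of `a` at stage `k` has the same class as `a`, so it generates the same principal
  -- ideal.
  refine ⟨k, _, hk, RoundIdeal.ext' (h := isRound_alg K) (Set.ext fun x => ?_)⟩
  refine (mem_cuColimι K k _ x).trans (Iff.trans ?_ (hA x).symm)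
  rw [cuAlgOf_map]

/-- As `a` is compact, its class lies in the ideal it generates, hence in the ideal of `b`. Thus the
two classes are related by `cuAlgRel`, which is witnessed by a relation `≪` at a single stage. -/
theorem cuColim_compact_le {i j : I} {a : K.obj i} {b : K.obj j} (ha : a ≪ a)
    (h : ((cuCocone K).ι.app i).hom a ≤ ((cuCocone K).ι.app j).hom b) :
    ∃ k, ∃ hik : i ≤ k, ∃ hjk : j ≤ k, cuSys K i k hik a ≤ cuSys K j k hjk b := by
  have hm : cuAlgRel K (cuAlgOf K i a) (cuAlgOf K j b) :=
    (mem_cuColimι K j b _).1 (h ((mem_cuColimι K i a _).2 ⟨i, a, a, ha, rfl, rfl⟩))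
  obtain ⟨l, hjl, -, c, e, hc⟩ := cuAlgRel_later K hm j
  obtain ⟨k, hik, hlk, e⟩ := pomOf_eq (K ⋙ forgetCu) e
  refine ⟨k, hik, hjl.trans hlk, ?_⟩
  have e : cuSys K i k hik a = cuSys K l k hlk c := e
  have t : cuSys K l k hlk (cuSys K j l hjl b) = cuSys K j k (hjl.trans hlk) b :=
    pomSys_trans (K ⋙ forgetCu) hjl hlk b
  rw [e, ← t]
  exact (cuSys K l k hlk).monotone' hc.le

/-- Passing to compact elements preserves directed colimits. -/
instance preservesColimit_compacts : PreservesColimit K compacts.{u} := by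
  refine preservesColimit_of_preserves_colimit_cocone (cuCoconeIsColimit K) ?_
  -- The canonical comparison from the direct limit of the compact parts; the image cocone is a
  -- colimit once `q` is invertible.
  let q := (pomCoconeIsColimit (K ⋙ compacts)).desc (compacts.mapCocone (cuCocone K))
  have hq : IsIso q := by
    refine PoM.isIso_of_surjective q (fun x y h => ?_) fun x => ?_
    · obtain ⟨i, a, rfl⟩ := exists_pomOf (K ⋙ compacts) x
      obtain ⟨j, b, rfl⟩ := exists_pomOf (K ⋙ compacts) y
      -- On representatives `q` is by definition the coprojection into the completion, so `h`
      -- already has the required form.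
      obtain ⟨k, hik, hjk, hab⟩ := cuColim_compact_le K (a := a.1) (b := b.1) a.2 h
      exact ⟨k, pomSys (K ⋙ compacts) i k hik a, pomSys (K ⋙ compacts) j k hjk b, hab,
        (pomOf_map _ hik a).symm, (pomOf_map _ hjk b).symm⟩
    · obtain ⟨i, a, ha, hx⟩ := cuColim_exists_compact K x.2
      exact ⟨pomOf (K ⋙ compacts) i ⟨a, ha⟩, Subtype.ext hx⟩
  exact IsColimit.ofPointIso (pomCoconeIsColimit (K ⋙ compacts)) (i := hq)

/-- The same descent for the chosen colimit, obtained by transport along the unique isomorphism of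
cocones; it starts the lifting argument for ultraproducts. -/
theorem colimit_exists_compact {x : (colimit K : Cu.{u})} (hx : x ≪ x) :
    ∃ i, ∃ a : K.obj i, a ≪ a ∧ (colimit.ι K i).hom a = x := by
  let φ := (cuCoconeIsColimit K).coconePointUniqueUpToIso (colimit.isColimit K)
  obtain ⟨i, a, ha, e⟩ := cuColim_exists_compact K (φ.inv.map_wayBelow _ _ hx)
  refine ⟨i, a, ha, ?_⟩
  have hφ : (cuCocone K).ι.app i ≫ φ.hom = colimit.ι K i :=
    IsColimit.comp_coconePointUniqueUpToIso_hom _ _ i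
  rw [← hφ, Cu.comp_hom, e, ← Cu.comp_hom, Iso.inv_hom_id, Cu.id_hom]

end Colimits

/-! ### Compact elements of ultraproducts -/

section Ultraproduct

variable {J : Type u} (U : Ultrafilter J) (S : J → Cu.{u})

/-- The compact elements of the products over the members of an ultrafilter. -/
noncomputable def compactsUltraDiagramIso :
    ultraDiagram U S ⋙ compacts ≅ ultraDiagram U fun j => compacts.obj (S j) :=
  NatIso.ofComponents (fun F => @asIso _ _ _ _ (piComparison compacts fun j : F.set => S j)
    (isIso_piComparison_compacts _)) (by
    intro F G f
    -- The transition maps restrict families to a smaller index set, so the squares commute on each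
    -- coordinate.
    refine Pi.hom_ext _ _ fun j => ?_
    simp [ultraDiagram])

/-- The compact elements of an ultraproduct are the ultraproduct of the compact elements. -/
noncomputable def compactsUltraproductIso :
    compacts.obj (ultraproduct U S) ≅ ultraproduct U fun j => compacts.obj (S j) :=
  preservesColimitIso compacts (ultraDiagram U S) ≪≫
    HasColimit.isoOfNatIso (compactsUltraDiagramIso U S)

/-- Each of the two factors of the isomorphism is characterised by its effect on coprojections;
chaining these leaves the component at `F` of `compactsUltraDiagramIso`, which is the product
comparison map. -/
theorem map_ultraproductι_compactsUltraproductIso (F : UltraIndex U) :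
    compacts.map (ultraproductι U S F) ≫ (compactsUltraproductIso U S).hom =
      piComparison compacts (fun j : F.set => S j) ≫
        ultraproductι U (fun j => compacts.obj (S j)) F := by
  change compacts.map (colimit.ι (ultraDiagram U S) F) ≫
    (preservesColimitIso compacts (ultraDiagram U S)).hom ≫
      (HasColimit.isoOfNatIso (compactsUltraDiagramIso U S)).hom = _
  rw [ι_preservesColimitIso_hom_assoc, HasColimit.isoOfNatIso_ι_hom]
  rfl

theorem ultraproductι_map {C : Type*} [Category* C] [HasProducts.{u} C]
    [HasColimitsOfShape (UltraIndex U) C] {X Y : J → C} (α : ∀ j, X j ⟶ Y j) (F : UltraIndex U) :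
    ultraproductι U X F ≫ ultraproductMap U α =
      Limits.Pi.map (fun j : F.set => α j) ≫ ultraproductι U Y F :=
  ι_colimMap (ultraDiagramMap U α) F

theorem compactsUltraproductIso_naturality {T : J → Cu.{u}} (α : ∀ j, S j ⟶ T j) :
    compacts.map (ultraproductMap U α) ≫ (compactsUltraproductIso U T).hom =
      (compactsUltraproductIso U S).hom ≫ ultraproductMap U fun j => compacts.map (α j) := by
  -- Because `compacts` preserves this colimit, the images of the coprojections are jointly
  -- epimorphic, and it suffices to compare on each stage `F`.
  refine (isColimitOfPreserves compacts (colimit.isColimit (ultraDiagram U S))).hom_ext fun F => ?_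
  change compacts.map (ultraproductι U S F) ≫ _ = compacts.map (ultraproductι U S F) ≫ _
  rw [← Functor.map_comp_assoc, ultraproductι_map, Functor.map_comp_assoc,
    map_ultraproductι_compactsUltraproductIso,
    ← Category.assoc (compacts.map (ultraproductι U S F)),
    map_ultraproductι_compactsUltraproductIso, Category.assoc, ultraproductι_map,
    ← Category.assoc, ← Category.assoc]
  -- What remains is naturality of the product comparison map over `F`, checked on projections.
  congr 1
  refine Pi.hom_ext _ _ fun j => ?_
  simp [← Functor.map_comp]

/-- Compact elements lift along the natural map from the product to the ultraproduct. -/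
theorem ultraproductπ_exists_compact {x : (ultraproduct U S : Cu.{u})} (hx : x ≪ x) :
    ∃ y : (∏ᶜ S : Cu.{u}), y ≪ y ∧ (ultraproductπ U S).hom y = x := by
  classical
  obtain ⟨F, a, ha, rfl⟩ := colimit_exists_compact (ultraDiagram U S) hx
  let p (j : F.set) := Pi.π (fun j : F.set => S j) j
  -- The coordinates of `a` are kept on `F` and extended by `0`, which is compact in any
  -- Cu-semigroup.
  obtain ⟨y, hy, hyπ⟩ := pi_exists_compact S
    (fun j => if h : j ∈ F.set then (p ⟨j, h⟩).hom a else 0) fun j => by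
      split_ifs with h
      · exact (p ⟨j, h⟩).map_wayBelow _ _ ha
      · exact zero_wayBelow 0
  refine ⟨y, hy, ?_⟩
  -- Under reverse inclusion the full set is the least index, so it maps to `F`.
  let f : (OrderDual.toDual ⟨Set.univ, Filter.univ_mem⟩ : UltraIndex U) ⟶ F :=
    homOfLE (Set.subset_univ F.set)
  let ρ : ∏ᶜ S ⟶ ∏ᶜ fun j : F.set => S j := Pi.lift fun j => Pi.π S j
  -- The natural map is defined through the stage of the full set; the cocone relation along `f`
  -- lets it be computed by restricting to `F`.
  have hπ : ultraproductπ U S = ρ ≫ ultraproductι U S F := by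
    let σ : ∏ᶜ S ⟶ (ultraDiagram U S).obj (OrderDual.toDual ⟨Set.univ, Filter.univ_mem⟩) :=
      Pi.lift fun j : (Set.univ : Set J) => Pi.π S j
    have hρ : σ ≫ (ultraDiagram U S).map f = ρ := by
      refine Pi.hom_ext _ _ fun j => ?_
      change (Pi.lift (fun j : (Set.univ : Set J) => Pi.π S j) ≫ Pi.lift fun j : F.set =>
        Pi.π (fun j : (Set.univ : Set J) => S j) ⟨j, trivial⟩) ≫ _ = _
      rw [Category.assoc, Pi.lift_π, Pi.lift_π, Pi.lift_π]
    change σ ≫ colimit.ι (ultraDiagram U S) _ = ρ ≫ colimit.ι (ultraDiagram U S) F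
    rw [← colimit.w (ultraDiagram U S) f, ← Category.assoc, hρ]
    rfl
  rw [hπ, Cu.comp_hom]
  refine congrArg (ultraproductι U S F).hom ?_
  have key (j : F.set) : (p j).hom (ρ.hom y) = (p j).hom a := by
    have hj : ρ ≫ p j = Pi.π S j := Pi.lift_π _ _
    rw [← Cu.comp_hom, hj, hyπ, dif_pos j.2]
  -- The restriction of `y` and `a` are both compact in the product over `F`, so agreement of all
  -- coordinates makes them equal.
  exact le_antisymm
    (pi_compact_le _ (ρ.map_wayBelow _ _ hy) ha fun j => (key j).le)
    (pi_compact_le _ ha (ρ.map_wayBelow _ _ hy) fun j => (key j).ge)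

end Ultraproduct

end Cuntz

open Cuntz
theorem mainTheorem10 :
    -- compact elements of products, via the projections
    (∀ (J : Type u) (S : J → Cu.{u}),
      ∃ e : compactElements (∏ᶜ S : Cu.{u}) ≃+o (∀ j, compactElements (S j)),
        ∀ y j, (e y j : S j) = (Pi.π S j).hom (y : (∏ᶜ S : Cu.{u}))) ∧
    (∀ (J : Type u) (U : Ultrafilter J),
      -- a natural isomorphism between the compact elements of the ultraproduct and the
      -- ultraproduct, in the category of positively ordered monoids, of the compact elements
      (∃ e : ∀ S : J → Cu.{u},
          compacts.obj (ultraproduct U S) ≅ ultraproduct U fun j => compacts.obj (S j),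
        (∀ (S : J → Cu.{u}) (F : UltraIndex U),
          compacts.map (ultraproductι U S F) ≫ (e S).hom =
            piComparison compacts (fun j : F.set => S j) ≫
              ultraproductι U (fun j => compacts.obj (S j)) F) ∧
        (∀ (S T : J → Cu.{u}) (α : ∀ j, S j ⟶ T j),
          compacts.map (ultraproductMap U α) ≫ (e T).hom =
            (e S).hom ≫ ultraproductMap U fun j => compacts.map (α j))) ∧
      -- compact elements lift along the natural map
      (∀ (S : J → Cu.{u}) (x : (ultraproduct U S : Cu.{u})), x ≪ x →
        ∃ y : (∏ᶜ S : Cu.{u}), y ≪ y ∧ (ultraproductπ U S).hom y = x)) :=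
  ⟨fun _ S => exists_compactElements_pi S, fun _ U =>
    ⟨⟨compactsUltraproductIso U, map_ultraproductι_compactsUltraproductIso U,
      fun S _ α => compactsUltraproductIso_naturality U S α⟩,
      fun S _ hx => ultraproductπ_exists_compact U S hx⟩⟩
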